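/- Let $(\mathcal H_i)_{i\in I}$ and $(\mathcal G_k)_{k\in K}$ be finite families of real Hilbert spaces with Hilbert direct sums $\mathcal H=\bigoplus_{i\in I}\mathcal H_i$ and $\mathcal G=\bigoplus_{k\in K}\mathcal G_k$. For a real Hilbert space $E$ and $A\colon E\to 2^E$, let $\operatorname{gra}A=\{(x,x^*)\in E\times E : x^*\in Ax\}$ and $\operatorname{zer}A=\{x\in E : 0\in Ax\}$; $A$ is maximally monotone if, for every $(x,x^*)\in E\times E$, one has $(x,x^*)\in\operatorname{gra}A$ if and only if $\langle x-y,x^*-y^*\rangle\ge 0$ for every $(y,y^*)\in\operatorname{gra}A$. An operator $T\colon E\to E$ is monotone if $\langle x-y,Tx-Ty\rangle\ge 0$ for all $x,y\in E$, and cocoercive with constant $\alpha\in\left]0,+\infty\right[$ if $\langle x-y,Tx-Ty\rangle\ge\alpha\|Tx-Ty\|^2$ for all $x,y\in E$. For every $i\in I$ and every $k\in K$, let $s_i^*\in\mathcal H_i$ and $r_k\in\mathcal G_k$, and suppose the following. - $A_i\colon\mathcal H_i\to2^{\mathcal H_i}$ is maximally monotone, $C_i\colon\mathcal H_i\to\mathcal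 H_i$ is cocoercive with constant $\alpha_i^{c}\in\left]0,+\infty\right[$, $Q_i\colon\mathcal H_i\to\mathcal H_i$ is monotone and Lipschitzian with constant $\alpha_i^{l}\in\left[0,+\infty\right[$, and $R_i\colon\mathcal H\to\mathcal H_i$. - $B_k^{m}\colon\mathcal G_k\to2^{\mathcal G_k}$ is maximally monotone, $B_k^{c}\colon\mathcal G_k\to\mathcal G_k$ is cocoercive with constant $\beta_k^{c}\in\left]0,+\infty\right[$, and $B_k^{l}\colon\mathcal G_k\to\mathcal G_k$ is monotone and Lipschitzian with constant $\beta_k^{l}\in\left[0,+\infty\right[$. - $D_k^{m}\colon\mathcal G_k\to2^{\mathcal G_k}$ is maximally monotone, $D_k^{c}\colon\mathcal G_k\to\mathcal G_k$ is cocoercive with constant $\delta_k^{c}\in\left]0,+\infty\right[$, and $D_k^{l}\colon\mathcal G_k\to\mathcal G_k$ is monotone and Lipschitzian with constant $\delta_k^{l}\in\left[0,+\infty\right[$. - $L_{ki}\colon\mathcal H_i\to\mathcal G_k$ is a bounded linear operator. - $R\colon\mathcal H\to\mathcal H\colon x\mapsto(R_ix)_{i\in I}$ is monotone and Lipschitzian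 with constant $\chi\in\left[0,+\infty\right[$. Let $X=\mathcal H\oplus\mathcal G\oplus\mathcal G\oplus\mathcal G$ (Hilbert direct sum). Define the saddle operator $S\colon X\to2^X$ by letting $S(x,y,z,v^*)$ be the product set $$\prod_{i\in I}\Big(-s_i^*+A_ix_i+C_ix_i+Q_ix_i+R_ix+\sum_{k\in K}L_{ki}^*v_k^*\Big)\times\prod_{k\in K}\big(B_k^{m}y_k+B_k^{c}y_k+B_k^{l}y_k-v_k^*\big)\times\prod_{k\in K}\big(D_k^{m}z_k+D_k^{c}z_k+D_k^{l}z_k-v_k^*\big)\times\prod_{k\in K}\Big\{r_k+y_k+z_k-\sum_{i\in I}L_{ki}x_i\Big\},$$ define $M\colon X\to2^X$ by letting $M(x,y,z,v^*)$ be $$\prod_{i\in I}\Big(-s_i^*+A_ix_i+Q_ix_i+R_ix+\sum_{k\in K}L_{ki}^*v_k^*\Big)\times\prod_{k\in K}\big(B_k^{m}y_k+B_k^{l}y_k-v_k^*\big)\times\prod_{k\in K}\big(D_k^{m}z_k+D_k^{l}z_k-v_k^*\big)\times\prod_{k\in K}\Big\{r_k+y_k+z_k-\sum_{i\in I}L_{ki}x_i\Big\},$$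 and define $C\colon X\to X$ by $$C(x,y,z,v^*)=\Big((C_ix_i)_{i\in I},(B_k^{c}y_k)_{k\in K},(D_k^{c}z_k)_{k\in K},0\Big).$$ Then the following hold. (i) $S=M+C$. (ii) $M$ is maximally monotone. (iii) Suppose that $I$ and $K$ are not both empty and set $\alpha=\min\{\alpha_i^{c},\beta_k^{c},\delta_k^{c}\}_{i\in I,k\in K}$. Then: (a) $C$ is cocoercive with constant $\alpha$ (in particular $\alpha>0$). (b) For every $(p,p^*)\in\operatorname{gra}M$ and every $q\in X$, $$\operatorname{zer}S\subset\Big\{x\in X : \langle x-p,p^*+Cq\rangle\le(4\alpha)^{-1}\|p-q\|^2\Big\}.$$ -/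

import Mathlib

open scoped Pointwise

noncomputable section

namespace SaddleForm

section Operators

variable {E : Type*} [NormedAddCommGroup E] [InnerProductSpace ℝ E]

/-- The graph of a set-valued operator `A : E → 2^E`. -/
def gra (A : E → Set E) : Set (E × E) := {p | p.2 ∈ A p.1}

/-- The set of zeros of a set-valued operator. -/
def zer (A : E → Set E) : Set E := {x | (0 : E) ∈ A x}

/-- Maximal monotonicity of a set-valued operator: `(x, x')` lies in the graph if and only if it is
monotonically related to every point of the graph. -/
def IsMaximallyMonotone (A : E → Set E) : Prop :=
  ∀ x x' : E, (x, x') ∈ gra A ↔ ∀ p ∈ gra A, 0 ≤ inner ℝ (x - p.1) (x' - p.2)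

/-- Monotonicity of a single-valued operator defined everywhere. -/
def IsMonotoneMap (T : E → E) : Prop :=
  ∀ x y : E, 0 ≤ inner ℝ (x - y) (T x - T y)

/-- Cocoercivity of a single-valued operator with constant `α ∈ ]0, +∞[`. -/
def IsCocoercive (α : ℝ) (T : E → E) : Prop :=
  0 < α ∧ ∀ x y : E, α * ‖T x - T y‖ ^ 2 ≤ inner ℝ (x - y) (T x - T y)

end Operators

universe u v w t

/-- The data and the standing assumptions of the system of monotone inclusions. The Hilbert direct
sums of the families `H` and `G` are `PiLp 2 H` and `PiLp 2 G`. -/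
structure InclusionProblem {I : Type u} {K : Type v} [Fintype I] [Fintype K]
    (H : I → Type w) [∀ i, NormedAddCommGroup (H i)] [∀ i, InnerProductSpace ℝ (H i)]
    (G : K → Type t) [∀ k, NormedAddCommGroup (G k)] [∀ k, InnerProductSpace ℝ (G k)] where
  s : ∀ i, H i
  r : ∀ k, G k
  A : ∀ i, H i → Set (H i)
  A_max : ∀ i, IsMaximallyMonotone (A i)
  C : ∀ i, H i → H i
  αc : I → ℝ
  C_coco : ∀ i, IsCocoercive (αc i) (C i)
  Q : ∀ i, H i → H i
  αl : I → NNReal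
  Q_mono : ∀ i, IsMonotoneMap (Q i)
  Q_lip : ∀ i, LipschitzWith (αl i) (Q i)
  R : ∀ i, PiLp 2 H → H i
  χ : NNReal
  R_mono : IsMonotoneMap (fun x : PiLp 2 H => (WithLp.toLp 2 (fun i => R i x) : PiLp 2 H))
  R_lip : LipschitzWith χ (fun x : PiLp 2 H => (WithLp.toLp 2 (fun i => R i x) : PiLp 2 H))
  Bm : ∀ k, G k → Set (G k)
  Bm_max : ∀ k, IsMaximallyMonotone (Bm k)
  Bc : ∀ k, G k → G k
  βc : K → ℝ
  Bc_coco : ∀ k, IsCocoercive (βc k) (Bc k)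
  Bl : ∀ k, G k → G k
  βl : K → NNReal
  Bl_mono : ∀ k, IsMonotoneMap (Bl k)
  Bl_lip : ∀ k, LipschitzWith (βl k) (Bl k)
  Dm : ∀ k, G k → Set (G k)
  Dm_max : ∀ k, IsMaximallyMonotone (Dm k)
  Dc : ∀ k, G k → G k
  δc : K → ℝ
  Dc_coco : ∀ k, IsCocoercive (δc k) (Dc k)
  Dl : ∀ k, G k → G k
  δl : K → NNReal
  Dl_mono : ∀ k, IsMonotoneMap (Dl k)
  Dl_lip : ∀ k, LipschitzWith (δl k) (Dl k)
  L : ∀ k i, H i →L[ℝ] G k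

section BigSpace

variable {I : Type u} {K : Type v} [Fintype I] [Fintype K]
variable (H : I → Type w) [∀ i, NormedAddCommGroup (H i)] [∀ i, InnerProductSpace ℝ (H i)]
variable (G : K → Type t) [∀ k, NormedAddCommGroup (G k)] [∀ k, InnerProductSpace ℝ (G k)]

/-- The Hilbert direct sum `𝓗 ⊕ 𝓖 ⊕ 𝓖 ⊕ 𝓖`. -/
abbrev BigSpace : Type (max u v w t) :=
  WithLp 2 (PiLp 2 H × WithLp 2 (PiLp 2 G × WithLp 2 (PiLp 2 G × PiLp 2 G)))

variable {H G}

/-- The point `(x, y, z, v)` of `𝓗 ⊕ 𝓖 ⊕ 𝓖 ⊕ 𝓖`. -/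
def mkBig (x : PiLp 2 H) (y z v : PiLp 2 G) : BigSpace H G :=
  WithLp.toLp 2 (x, WithLp.toLp 2 (y, WithLp.toLp 2 (z, v)))

/-- The first component `x` of a point `(x, y, z, v)`. -/
def xPart (p : BigSpace H G) : PiLp 2 H := p.fst

/-- The second component `y` of a point `(x, y, z, v)`. -/
def yPart (p : BigSpace H G) : PiLp 2 G := p.snd.fst

/-- The third component `z` of a point `(x, y, z, v)`. -/
def zPart (p : BigSpace H G) : PiLp 2 G := p.snd.snd.fst

/-- The fourth component `v` of a point `(x, y, z, v)`. -/
def vPart (p : BigSpace H G) : PiLp 2 G := p.snd.snd.snd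

/-- The product set `(⨉ i, S₁ i) × (⨉ k, S₂ k) × (⨉ k, S₃ k) × (⨉ k, S₄ k)`. -/
def box (S₁ : ∀ i, Set (H i)) (S₂ S₃ S₄ : ∀ k, Set (G k)) : Set (BigSpace H G) :=
  {p | (∀ i, xPart p i ∈ S₁ i) ∧ (∀ k, yPart p k ∈ S₂ k) ∧
    (∀ k, zPart p k ∈ S₃ k) ∧ (∀ k, vPart p k ∈ S₄ k)}

end BigSpace

namespace InclusionProblem

variable {I : Type u} {K : Type v} [Fintype I] [Fintype K]
variable {H : I → Type w} [∀ i, NormedAddCommGroup (H i)] [∀ i, InnerProductSpace ℝ (H i)]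
  [∀ i, CompleteSpace (H i)]
variable {G : K → Type t} [∀ k, NormedAddCommGroup (G k)] [∀ k, InnerProductSpace ℝ (G k)]
  [∀ k, CompleteSpace (G k)]

/-- The saddle operator. -/
def saddle (P : InclusionProblem H G) (p : BigSpace H G) : Set (BigSpace H G) :=
  box
    (fun i => {-P.s i} + P.A i (xPart p i) + {P.C i (xPart p i)} + {P.Q i (xPart p i)}
      + {P.R i (xPart p)} + {∑ k, (P.L k i).adjoint (vPart p k)})
    (fun k => P.Bm k (yPart p k) + {P.Bc k (yPart p k)} + {P.Bl k (yPart p k)} + {-vPart p k})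
    (fun k => P.Dm k (zPart p k) + {P.Dc k (zPart p k)} + {P.Dl k (zPart p k)} + {-vPart p k})
    (fun k => {P.r k + yPart p k + zPart p k - ∑ i, P.L k i (xPart p i)})

/-- The set-valued part `M` of the saddle operator. -/
def opM (P : InclusionProblem H G) (p : BigSpace H G) : Set (BigSpace H G) :=
  box
    (fun i => {-P.s i} + P.A i (xPart p i) + {P.Q i (xPart p i)}
      + {P.R i (xPart p)} + {∑ k, (P.L k i).adjoint (vPart p k)})
    (fun k => P.Bm k (yPart p k) + {P.Bl k (yPart p k)} + {-vPart p k})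
    (fun k => P.Dm k (zPart p k) + {P.Dl k (zPart p k)} + {-vPart p k})
    (fun k => {P.r k + yPart p k + zPart p k - ∑ i, P.L k i (xPart p i)})

/-- The single-valued part `C` of the saddle operator. -/
def opC (P : InclusionProblem H G) (p : BigSpace H G) : BigSpace H G :=
  mkBig
    (WithLp.toLp 2 (fun i => P.C i (xPart p i)))
    (WithLp.toLp 2 (fun k => P.Bc k (yPart p k)))
    (WithLp.toLp 2 (fun k => P.Dc k (zPart p k)))
    0

/-- The set of all the cocoercivity constants of the problem; it is finite, and it is nonempty
unless both families of spaces are empty. -/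
def cocoConstants (P : InclusionProblem H G) : Set ℝ :=
  Set.range P.αc ∪ Set.range P.βc ∪ Set.range P.δc

end InclusionProblem

end SaddleForm

end

/-! Write `M = N + T`, where `N` (`opN`) is the product of the `A i`, `Bm k`, `Dm k` and the zero
operator, and `T` (`diag + skew`) is monotone and Lipschitz: the couplings through `L` and through
`v` form a skew linear map, the remaining single-valued terms are monotone. By Minty's theorem each
factor has resolvents with full domain, hence so does `N`, and `isMaximallyMonotone_of_lipschitz`
transfers maximality to `N + T`. Minty's theorem is derived from Kirszbraun's intersection property:
concave maximization over a simplex for finite families, then weak-* compactness.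

The half-space bound combines monotonicity of `M` between `(x, -C x)` and `(p, p')`, for `x` a zero
of the saddle operator, with the cocoercivity estimate `IsCocoercive.inner_sub_le`. -/

noncomputable section

namespace SaddleForm

set_option linter.unusedSectionVars false

/-! ### Kirszbraun's intersection property, Minty's theorem and Lipschitz perturbations. -/

section Minty

variable {E : Type*} [NormedAddCommGroup E] [InnerProductSpace ℝ E]

/-- The minimum over `x` of the weighted sum of the functions `‖x - a i‖ ^ 2 - ‖b i‖ ^ 2`, as a
function of the weights. -/
def dualValue {ι : Type*} [Fintype ι] (a b : ι → E) (l : ι → ℝ) : ℝ :=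
  ∑ i, l i * (‖a i‖ ^ 2 - ‖b i‖ ^ 2) - ‖∑ i, l i • a i‖ ^ 2

/-- Variance identity: it turns hypotheses on pairwise distances into information on `dualValue`. -/
theorem sum_mul_norm_sub_sq {ι : Type*} [Fintype ι] (a : ι → E) {l : ι → ℝ}
    (hl : ∑ i, l i = 1) :
    ∑ i, ∑ j, l i * l j * ‖a i - a j‖ ^ 2 =
      2 * (∑ i, l i * ‖a i‖ ^ 2 - ‖∑ i, l i • a i‖ ^ 2) := by
  have h1 : ‖∑ i, l i • a i‖ ^ 2 = ∑ i, ∑ j, l i * l j * inner ℝ (a i) (a j) := by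
    rw [← real_inner_self_eq_norm_sq, sum_inner]
    refine Finset.sum_congr rfl fun i _ => ?_
    rw [inner_sum]
    refine Finset.sum_congr rfl fun j _ => ?_
    rw [real_inner_smul_left, real_inner_smul_right]
    ring
  have h2 : ∑ i, ∑ j, l i * l j * ‖a i‖ ^ 2 = ∑ i, l i * ‖a i‖ ^ 2 := by
    refine Finset.sum_congr rfl fun i _ => ?_
    rw [← Finset.sum_mul, ← Finset.mul_sum, hl, mul_one]
  have h3 : ∑ i, ∑ j, l i * l j * ‖a j‖ ^ 2 = ∑ i, l i * ‖a i‖ ^ 2 := by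
    rw [Finset.sum_comm]
    refine Finset.sum_congr rfl fun i _ => ?_
    rw [← Finset.sum_mul, ← Finset.sum_mul, hl, one_mul]
  have h4 : ∀ i j, l i * l j * ‖a i - a j‖ ^ 2 = l i * l j * ‖a i‖ ^ 2 + l i * l j * ‖a j‖ ^ 2
      - 2 * (l i * l j * inner ℝ (a i) (a j)) := fun i j => by
    rw [norm_sub_sq_real]; ring
  simp only [h4, Finset.sum_sub_distrib, Finset.sum_add_distrib, ← Finset.mul_sum, h1, h2, h3]
  ring

/-- By the variance identity for `a` and for `b`, the dual value is half the weighted sum of `‖a i -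
a j‖ ^ 2 - ‖b i - b j‖ ^ 2`, minus `‖∑ i, l i • b i‖ ^ 2`. -/
theorem dualValue_nonpos {ι : Type*} [Fintype ι] {a b : ι → E}
    (hab : ∀ i j, ‖a i - a j‖ ≤ ‖b i - b j‖) {l : ι → ℝ} (hl : l ∈ stdSimplex ℝ ι) :
    dualValue a b l ≤ 0 := by
  have ha := sum_mul_norm_sub_sq a hl.2
  have hb := sum_mul_norm_sub_sq b hl.2
  have h : ∑ i, ∑ j, l i * l j * ‖a i - a j‖ ^ 2 ≤ ∑ i, ∑ j, l i * l j * ‖b i - b j‖ ^ 2 := by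
    refine Finset.sum_le_sum fun i _ => Finset.sum_le_sum fun j _ => ?_
    exact mul_le_mul_of_nonneg_left (pow_le_pow_left₀ (norm_nonneg _) (hab i j) 2)
      (mul_nonneg (hl.1 i) (hl.1 j))
  have : 0 ≤ ‖∑ i, l i • b i‖ ^ 2 := by positivity
  simp only [dualValue, mul_sub, Finset.sum_sub_distrib]
  linarith

/-- Exact expansion along the segment from `l` to vertex `j`; the coefficient of `t` supplies the
first-order condition at a maximizer. -/
theorem dualValue_lineMap {ι : Type*} [Fintype ι] [DecidableEq ι] (a b : ι → E) (l : ι → ℝ) (j : ι)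
    (t : ℝ) :
    dualValue a b ((1 - t) • l + t • Pi.single j 1) = dualValue a b l
      + t * (‖(∑ i, l i • a i) - a j‖ ^ 2 - ‖b j‖ ^ 2 - dualValue a b l)
      - t ^ 2 * ‖(∑ i, l i • a i) - a j‖ ^ 2 := by
  have h1 : ∑ i, ((1 - t) • l + t • Pi.single j 1 : ι → ℝ) i • a i
      = (∑ i, l i • a i) - t • ((∑ i, l i • a i) - a j) := by
    simp only [Pi.add_apply, Pi.smul_apply, smul_eq_mul, add_smul, mul_smul, Finset.sum_add_distrib,
      ← Finset.smul_sum, Pi.single_apply, ite_smul, one_smul, zero_smul, Finset.sum_ite_eq',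
      Finset.mem_univ, if_true]
    module
  have h2 : ∑ i, ((1 - t) • l + t • Pi.single j 1 : ι → ℝ) i * (‖a i‖ ^ 2 - ‖b i‖ ^ 2)
      = (1 - t) * ∑ i, l i * (‖a i‖ ^ 2 - ‖b i‖ ^ 2) + t * (‖a j‖ ^ 2 - ‖b j‖ ^ 2) := by
    simp only [Pi.add_apply, Pi.smul_apply, smul_eq_mul, add_mul, mul_assoc, Finset.sum_add_distrib,
      ← Finset.mul_sum, Pi.single_apply, ite_mul, one_mul, zero_mul, Finset.sum_ite_eq',
      Finset.mem_univ, if_true]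
  unfold dualValue
  rw [h1, h2]
  generalize (∑ i, l i • a i) = c
  rw [norm_sub_sq_real, real_inner_smul_right, inner_sub_right, norm_smul, mul_pow,
    norm_sub_sq_real, Real.norm_eq_abs, sq_abs, real_inner_self_eq_norm_sq]
  ring

/-- The finite form of Kirszbraun's intersection property. -/
theorem exists_forall_norm_sub_le {ι : Type*} [Fintype ι] {a b : ι → E}
    (hab : ∀ i j, ‖a i - a j‖ ≤ ‖b i - b j‖) : ∃ x : E, ∀ i, ‖x - a i‖ ≤ ‖b i‖ := by
  classical
  rcases isEmpty_or_nonempty ι with hι | ⟨⟨i₀⟩⟩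
  · exact ⟨0, fun i => isEmptyElim i⟩
  have hcont : Continuous (dualValue a b) := by unfold dualValue; fun_prop
  obtain ⟨l, hl, hmax⟩ := (isCompact_stdSimplex ℝ ι).exists_isMaxOn
    ⟨_, single_mem_stdSimplex ℝ i₀⟩ hcont.continuousOn
  -- The point sought is the barycentre of the `a i` for the maximizing weights.
  refine ⟨∑ i, l i • a i, fun j => ?_⟩
  have h0 := dualValue_nonpos hab hl
  -- Optimality: the slope of `dualValue` from `l` towards any vertex is nonpositive.
  have key : ‖(∑ i, l i • a i) - a j‖ ^ 2 - ‖b j‖ ^ 2 - dualValue a b l ≤ 0 := by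
    set g := ‖(∑ i, l i • a i) - a j‖ ^ 2 - ‖b j‖ ^ 2 - dualValue a b l with hg
    set n := ‖(∑ i, l i • a i) - a j‖ ^ 2 with hn
    have hn0 : 0 ≤ n := by positivity
    have hle : ∀ t : ℝ, 0 < t → t ≤ 1 → g ≤ t * n := fun t ht ht1 => by
      have hmem := convex_stdSimplex ℝ ι hl (single_mem_stdSimplex ℝ j)
        (sub_nonneg.2 ht1) ht.le (sub_add_cancel 1 t)
      have := hmax hmem
      rw [Set.mem_ofPred_eq, dualValue_lineMap, ← hn, ← hg] at this
      have h2 : t * g ≤ t * (t * n) := by linarith [show t ^ 2 * n = t * (t * n) by ring]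
      exact le_of_mul_le_mul_left h2 ht
    by_contra! hpos
    -- At this `t` the bound `g ≤ t * n` reads `g * (g + 2 * n) ≤ g * n`, impossible for `g > 0`.
    have ht : 0 < g / (g + n + n) := by positivity
    have := hle (g / (g + n + n)) ht ((div_le_one (by positivity)).2 (by linarith))
    rw [div_mul_eq_mul_div, le_div_iff₀ (by positivity)] at this
    nlinarith [mul_nonneg hpos.le hn0, mul_pos hpos hpos]
  exact le_of_sq_le_sq (by linarith) (norm_nonneg _)

/-- Kirszbraun's intersection property. -/
theorem exists_forall_norm_sub_le_of_complete [CompleteSpace E] {ι : Type*} {a b : ι → E}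
    (hab : ∀ i j, ‖a i - a j‖ ≤ ‖b i - b j‖) : ∃ x : E, ∀ i, ‖x - a i‖ ≤ ‖b i‖ := by
  rcases isEmpty_or_nonempty ι with hι | ⟨⟨i₀⟩⟩
  · exact ⟨0, fun i => isEmptyElim i⟩
  -- Through the Riesz isometry the balls become weak-* closed, and one of them, indexed by `i₀`, is
  -- weak-* compact; the finite case gives the finite intersection property.
  let t : ι → Set (WeakDual ℝ E) := fun i =>
    WeakDual.toStrongDual ⁻¹' Metric.closedBall (InnerProductSpace.toDual ℝ E (a i)) ‖b i‖
  have hmem : ∀ i x, StrongDual.toWeakDual (InnerProductSpace.toDual ℝ E x) ∈ t i ↔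
      ‖x - a i‖ ≤ ‖b i‖ := fun i x => by
    simp only [t, Set.mem_preimage, Metric.mem_closedBall, dist_eq_norm]
    change ‖InnerProductSpace.toDual ℝ E x - InnerProductSpace.toDual ℝ E (a i)‖ ≤ _ ↔ _
    rw [← map_sub, LinearIsometryEquiv.norm_map]
  obtain ⟨f, -, hf⟩ := (WeakDual.isCompact_closedBall
    (InnerProductSpace.toDual ℝ E (a i₀)) ‖b i₀‖).inter_iInter_nonempty t
    (fun i => WeakDual.isClosed_closedBall _ _) fun u => by
      classical
      obtain ⟨x, hx⟩ := exists_forall_norm_sub_le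
        (a := fun i : (insert i₀ u : Finset ι) => a i) (b := fun i => b i) fun i j => hab i j
      refine ⟨StrongDual.toWeakDual (InnerProductSpace.toDual ℝ E x),
        (hmem i₀ x).2 (hx ⟨i₀, Finset.mem_insert_self _ _⟩), ?_⟩
      exact Set.mem_iInter₂.2 fun i hi => (hmem i x).2 (hx ⟨i, Finset.mem_insert_of_mem hi⟩)
  refine ⟨(InnerProductSpace.toDual ℝ E).symm (WeakDual.toStrongDual f), fun i => ?_⟩
  rw [← hmem, LinearIsometryEquiv.apply_symm_apply]
  exact Set.mem_iInter.1 hf i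

theorem IsMaximallyMonotone.inner_nonneg {A : E → Set E} (hA : IsMaximallyMonotone A) {x x' y y' : E}
    (hx : x' ∈ A x) (hy : y' ∈ A y) : 0 ≤ inner ℝ (x - y) (x' - y') :=
  (hA x x').1 hx (y, y') hy

/-- Minty's theorem. -/
theorem IsMaximallyMonotone.exists_add_smul_eq [CompleteSpace E] {A : E → Set E}
    (hA : IsMaximallyMonotone A) {c : ℝ} (hc : 0 < c) (z : E) :
    ∃ x x', x' ∈ A x ∧ x + c • x' = z := by
  -- Polarization: with `a` and `b` half the difference and half the sum of `y - z` and `c • y'`,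
  -- monotonicity of `A` is exactly the distance hypothesis of Kirszbraun's property.
  have h4 : ∀ u w : E, ‖u + w‖ ^ 2 - ‖u - w‖ ^ 2 = 4 * inner ℝ u w := fun u w => by
    rw [norm_add_sq_real, norm_sub_sq_real]; ring
  obtain ⟨x, hx⟩ := exists_forall_norm_sub_le_of_complete
    (a := fun p : gra A => (2⁻¹ : ℝ) • ((p.1.1 - z) - c • p.1.2))
    (b := fun p : gra A => (2⁻¹ : ℝ) • ((p.1.1 - z) + c • p.1.2)) (by
      rintro ⟨⟨y, y'⟩, hy⟩ ⟨⟨w, w'⟩, hw⟩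
      dsimp only
      rw [← smul_sub, ← smul_sub, norm_smul, norm_smul]
      refine mul_le_mul_of_nonneg_left (le_of_sq_le_sq ?_ (norm_nonneg _)) (norm_nonneg _)
      have := h4 (y - w) (c • (y' - w'))
      have hm : 0 ≤ inner ℝ (y - w) (c • (y' - w')) := by
        rw [real_inner_smul_right]; exact mul_nonneg hc.le (hA.inner_nonneg hy hw)
      rw [show y - z - c • y' - (w - z - c • w') = y - w - c • (y' - w') by module,
        show y - z + c • y' - (w - z + c • w') = y - w + c • (y' - w') by module]
      linarith)
  -- The ball inequalities say, by the same polarization, that this pair is monotonically related to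
  -- the whole graph; maximality puts it there.
  refine ⟨z + x, -(c⁻¹ • x), (hA _ _).2 ?_, ?_⟩
  · rintro ⟨y, y'⟩ hy
    have h := pow_le_pow_left₀ (norm_nonneg _) (hx ⟨(y, y'), hy⟩) 2
    have e := h4 ((2⁻¹ : ℝ) • (z + x - y)) ((2⁻¹ : ℝ) • (-x - c • y'))
    rw [show (2⁻¹ : ℝ) • (z + x - y) + (2⁻¹ : ℝ) • (-x - c • y')
        = -((2⁻¹ : ℝ) • ((y - z) + c • y')) by module,
      show (2⁻¹ : ℝ) • (z + x - y) - (2⁻¹ : ℝ) • (-x - c • y')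
        = x - (2⁻¹ : ℝ) • ((y - z) - c • y') by module, norm_neg, real_inner_smul_left,
      real_inner_smul_right] at e
    dsimp only at h ⊢
    rw [show -(c⁻¹ • x) - y' = c⁻¹ • (-x - c • y') by
      rw [smul_sub, inv_smul_smul₀ hc.ne', smul_neg], real_inner_smul_right]
    exact mul_nonneg (inv_nonneg.2 hc.le) (by linarith)
  · rw [smul_neg, smul_inv_smul₀ hc.ne', add_neg_cancel_right]

/-- The sum of a monotone operator with full resolvent ranges and a monotone Lipschitz map is
maximally monotone. -/
theorem isMaximallyMonotone_of_lipschitz {N M : E → Set E} {T : E → E}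
    (hM : ∀ x x', x' ∈ M x ↔ x' - T x ∈ N x)
    (hN : ∀ x x' y y', x' ∈ N x → y' ∈ N y → 0 ≤ inner ℝ (x - y) (x' - y'))
    (hsurj : ∀ c : ℝ, 0 < c → ∀ z, ∃ x x', x' ∈ N x ∧ x + c • x' = z)
    (hT : IsMonotoneMap T) {L : NNReal} (hL : LipschitzWith L T) : IsMaximallyMonotone M := by
  refine fun x x' => ⟨fun hx p hp => ?_, fun h => ?_⟩
  · have h1 := hN _ _ _ _ ((hM _ _).1 hx) ((hM _ _).1 hp)
    have h2 := hT x p.1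
    rw [show x' - p.2 = (x' - T x - (p.2 - T p.1)) + (T x - T p.1) by abel, inner_add_right]
    exact add_nonneg h1 h2
  -- The step makes `x' - T x - y' = -(L + 1) • (x - y)`. Testing against `(y, y' + T y)` then gives
  -- `(L + 1) * ‖x - y‖ ^ 2 ≤ L * ‖x - y‖ ^ 2`, so `x = y`; any factor above `L` would do.
  · obtain ⟨y, y', hy, hyx⟩ := hsurj ((L : ℝ) + 1)⁻¹ (by positivity)
      (x + ((L : ℝ) + 1)⁻¹ • (x' - T x))
    have hc : (L : ℝ) + 1 ≠ 0 := by positivity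
    have e : x' - T x - y' = -(((L : ℝ) + 1) • (x - y)) := by
      have := congrArg (fun u => ((L : ℝ) + 1) • u) hyx
      simp only [smul_add, smul_inv_smul₀ hc] at this
      rw [smul_sub]
      rw [add_comm, ← sub_eq_iff_eq_add] at this
      rw [← sub_eq_zero]
      rw [← sub_eq_zero] at this
      rw [← neg_eq_zero, ← this]
      abel
    have h1 := h (y, y' + T y) ((hM _ _).2 (by simpa using hy))
    dsimp only at h1
    rw [show x' - (y' + T y) = (x' - T x - y') + (T x - T y) by abel, e, inner_add_right,
      inner_neg_right, real_inner_smul_right, real_inner_self_eq_norm_sq] at h1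
    have h2 := (real_inner_le_norm (x - y) (T x - T y)).trans
      (mul_le_mul_of_nonneg_left (hL.norm_sub_le x y) (norm_nonneg _))
    have h3 : ‖x - y‖ = 0 := by
      have : ‖x - y‖ ^ 2 ≤ 0 := by linarith
      exact pow_eq_zero_iff two_ne_zero |>.1 (le_antisymm this (by positivity))
    have hxy : x = y := sub_eq_zero.1 (norm_eq_zero.1 h3)
    subst hxy
    rw [sub_self, smul_zero, neg_zero, sub_eq_zero] at e
    exact (hM _ _).2 (e ▸ hy)

end Minty

/-- Splitting `x - p` at `q`, cocoercivity and Cauchy–Schwarz bound the left side by `‖p - q‖ * d -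
α * d ^ 2` with `d = ‖T x - T q‖`; completing the square gives the constant. -/
theorem IsCocoercive.inner_sub_le {E : Type*} [NormedAddCommGroup E] [InnerProductSpace ℝ E]
    {α : ℝ} {T : E → E} (hT : IsCocoercive α T) (x p q : E) :
    inner ℝ (x - p) (T q - T x) ≤ (4 * α)⁻¹ * ‖p - q‖ ^ 2 := by
  obtain ⟨hα, hT⟩ := hT
  have h1 := hT x q
  have h2 := real_inner_le_norm (p - q) (T x - T q)
  have e : inner ℝ (x - p) (T q - T x)
      = inner ℝ (p - q) (T x - T q) - inner ℝ (x - q) (T x - T q) := by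
    rw [← inner_sub_left, ← neg_sub (T x) (T q), inner_neg_right, ← inner_neg_left]
    congr 1; abel
  rw [e, inv_mul_eq_div, le_div_iff₀ (by positivity)]
  nlinarith [sq_nonneg (‖p - q‖ - 2 * α * ‖T x - T q‖)]

/-! ### Lipschitz maps with unspecified constant: maximality needs only that one exists. -/

/-- The property of being Lipschitz continuous for some constant. -/
def IsLipschitz {X Y : Type*} [PseudoEMetricSpace X] [PseudoEMetricSpace Y] (f : X → Y) : Prop :=
  ∃ c : NNReal, LipschitzWith c f

namespace IsLipschitz

variable {X Y Z : Type*}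

theorem comp [PseudoEMetricSpace X] [PseudoEMetricSpace Y] [PseudoEMetricSpace Z]
    {g : Y → Z} {f : X → Y} (hg : IsLipschitz g) (hf : IsLipschitz f) :
    IsLipschitz fun x => g (f x) :=
  let ⟨_, hg⟩ := hg
  let ⟨_, hf⟩ := hf
  ⟨_, hg.comp hf⟩

theorem const [PseudoEMetricSpace X] [PseudoEMetricSpace Y] (y : Y) :
    IsLipschitz fun _ : X => y :=
  ⟨0, LipschitzWith.const y⟩

theorem add [PseudoEMetricSpace X] [SeminormedAddCommGroup Y] {f g : X → Y} (hf : IsLipschitz f)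
    (hg : IsLipschitz g) : IsLipschitz fun x => f x + g x :=
  let ⟨_, hf⟩ := hf
  let ⟨_, hg⟩ := hg
  ⟨_, hf.add hg⟩

theorem toLp [PseudoEMetricSpace X] {ι : Type*} [Fintype ι] {Y : ι → Type*}
    [∀ i, PseudoEMetricSpace (Y i)] {f : ∀ i, X → Y i} (hf : ∀ i, IsLipschitz (f i)) :
    IsLipschitz fun x => (WithLp.toLp 2 (fun i => f i x) : PiLp 2 Y) := by
  choose c hc using hf
  have h : LipschitzWith (∑ i, c i) fun x i => f i x := fun x y =>
    edist_pi_le_iff.2 fun i => (hc i x y).trans (by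
      gcongr
      exact Finset.single_le_sum (f := c) (fun _ _ => zero_le) (Finset.mem_univ i))
  exact ⟨_, (PiLp.lipschitzWith_toLp 2 Y).comp h⟩

theorem sub [PseudoEMetricSpace X] [SeminormedAddCommGroup Y] {f g : X → Y} (hf : IsLipschitz f)
    (hg : IsLipschitz g) : IsLipschitz fun x => f x - g x :=
  let ⟨_, hf⟩ := hf
  let ⟨_, hg⟩ := hg
  ⟨_, hf.sub hg⟩

theorem sum [PseudoEMetricSpace X] [SeminormedAddCommGroup Y] {ι : Type*} [Fintype ι]
    {f : ι → X → Y} (hf : ∀ i, IsLipschitz (f i)) : IsLipschitz fun x => ∑ i, f i x := by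
  classical
  induction (Finset.univ : Finset ι) using Finset.induction_on with
  | empty => simpa using const (0 : Y)
  | insert i s hi ih => simpa only [Finset.sum_insert hi] using (hf i).add ih

theorem of_continuousLinearMap [SeminormedAddCommGroup X] [NormedSpace ℝ X]
    [SeminormedAddCommGroup Y] [NormedSpace ℝ Y] (f : X →L[ℝ] Y) : IsLipschitz f :=
  ⟨_, f.lipschitz⟩

end IsLipschitz

universe u v w t

/-! ### Coordinates, inner product and norm on the four-fold Hilbert sum. -/

section BigSpace

variable {I : Type u} {K : Type v} [Fintype I] [Fintype K]
variable {H : I → Type w} [∀ i, NormedAddCommGroup (H i)] [∀ i, InnerProductSpace ℝ (H i)]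
variable {G : K → Type t} [∀ k, NormedAddCommGroup (G k)] [∀ k, InnerProductSpace ℝ (G k)]

@[simp] theorem xPart_mkBig (x : PiLp 2 H) (y z v : PiLp 2 G) : xPart (mkBig x y z v) = x := rfl
@[simp] theorem yPart_mkBig (x : PiLp 2 H) (y z v : PiLp 2 G) : yPart (mkBig x y z v) = y := rfl
@[simp] theorem zPart_mkBig (x : PiLp 2 H) (y z v : PiLp 2 G) : zPart (mkBig x y z v) = z := rfl
@[simp] theorem vPart_mkBig (x : PiLp 2 H) (y z v : PiLp 2 G) : vPart (mkBig x y z v) = v := rfl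
@[simp] theorem xPart_add (p q : BigSpace H G) : xPart (p + q) = xPart p + xPart q := rfl
@[simp] theorem yPart_add (p q : BigSpace H G) : yPart (p + q) = yPart p + yPart q := rfl
@[simp] theorem zPart_add (p q : BigSpace H G) : zPart (p + q) = zPart p + zPart q := rfl
@[simp] theorem vPart_add (p q : BigSpace H G) : vPart (p + q) = vPart p + vPart q := rfl
@[simp] theorem xPart_sub (p q : BigSpace H G) : xPart (p - q) = xPart p - xPart q := rfl
@[simp] theorem yPart_sub (p q : BigSpace H G) : yPart (p - q) = yPart p - yPart q := rfl
@[simp] theorem zPart_sub (p q : BigSpace H G) : zPart (p - q) = zPart p - zPart q := rfl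
@[simp] theorem vPart_sub (p q : BigSpace H G) : vPart (p - q) = vPart p - vPart q := rfl
@[simp] theorem xPart_smul (c : ℝ) (p : BigSpace H G) : xPart (c • p) = c • xPart p := rfl
@[simp] theorem yPart_smul (c : ℝ) (p : BigSpace H G) : yPart (c • p) = c • yPart p := rfl
@[simp] theorem zPart_smul (c : ℝ) (p : BigSpace H G) : zPart (c • p) = c • zPart p := rfl
@[simp] theorem vPart_smul (c : ℝ) (p : BigSpace H G) : vPart (c • p) = c • vPart p := rfl

theorem bigSpace_ext {p q : BigSpace H G} (hx : ∀ i, xPart p i = xPart q i)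
    (hy : ∀ k, yPart p k = yPart q k) (hz : ∀ k, zPart p k = zPart q k)
    (hv : ∀ k, vPart p k = vPart q k) : p = q :=
  WithLp.ofLp_injective 2 <| Prod.ext (PiLp.ext hx) <| WithLp.ofLp_injective 2 <|
    Prod.ext (PiLp.ext hy) <| WithLp.ofLp_injective 2 <| Prod.ext (PiLp.ext hz) (PiLp.ext hv)

theorem inner_bigSpace (p q : BigSpace H G) :
    inner ℝ p q = inner ℝ (xPart p) (xPart q) + inner ℝ (yPart p) (yPart q)
      + inner ℝ (zPart p) (zPart q) + inner ℝ (vPart p) (vPart q) := by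
  rw [WithLp.prod_inner_apply, WithLp.prod_inner_apply, WithLp.prod_inner_apply, add_assoc,
    add_assoc]
  rfl

theorem norm_sq_bigSpace (p : BigSpace H G) :
    ‖p‖ ^ 2 = ‖xPart p‖ ^ 2 + ‖yPart p‖ ^ 2 + ‖zPart p‖ ^ 2 + ‖vPart p‖ ^ 2 := by
  simp only [← real_inner_self_eq_norm_sq, inner_bigSpace]

variable (H G) in
/-- The first component as a bounded linear map. -/
def xPartL : BigSpace H G →L[ℝ] PiLp 2 H where
  toFun := xPart
  map_add' _ _ := rfl
  map_smul' _ _ := rfl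
  cont := by unfold xPart; fun_prop

variable (H G) in
/-- The second component as a bounded linear map. -/
def yPartL : BigSpace H G →L[ℝ] PiLp 2 G where
  toFun := yPart
  map_add' _ _ := rfl
  map_smul' _ _ := rfl
  cont := by unfold yPart; fun_prop

variable (H G) in
/-- The third component as a bounded linear map. -/
def zPartL : BigSpace H G →L[ℝ] PiLp 2 G where
  toFun := zPart
  map_add' _ _ := rfl
  map_smul' _ _ := rfl
  cont := by unfold zPart; fun_prop

variable (H G) in
/-- The fourth component as a bounded linear map. -/
def vPartL : BigSpace H G →L[ℝ] PiLp 2 G where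
  toFun := vPart
  map_add' _ _ := rfl
  map_smul' _ _ := rfl
  cont := by unfold vPart; fun_prop

theorem IsLipschitz.mkBig {X : Type*} [SeminormedAddCommGroup X] {a : X → PiLp 2 H}
    {b c d : X → PiLp 2 G} (ha : IsLipschitz a) (hb : IsLipschitz b) (hc : IsLipschitz c)
    (hd : IsLipschitz d) : IsLipschitz fun p => mkBig (a p) (b p) (c p) (d p) := by
  obtain ⟨ca, ha⟩ := ha
  obtain ⟨cb, hb⟩ := hb
  obtain ⟨cc, hc⟩ := hc
  obtain ⟨cd, hd⟩ := hd
  refine ⟨ca + cb + cc + cd, LipschitzWith.of_dist_le_mul fun p q => ?_⟩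
  rw [dist_eq_norm, dist_eq_norm]
  refine le_of_sq_le_sq ?_ (by positivity)
  rw [norm_sq_bigSpace]
  simp only [xPart_sub, yPart_sub, zPart_sub, vPart_sub, xPart_mkBig, yPart_mkBig, zPart_mkBig,
    vPart_mkBig, NNReal.coe_add]
  have ha := pow_le_pow_left₀ (norm_nonneg _) (ha.norm_sub_le p q) 2
  have hb := pow_le_pow_left₀ (norm_nonneg _) (hb.norm_sub_le p q) 2
  have hc := pow_le_pow_left₀ (norm_nonneg _) (hc.norm_sub_le p q) 2
  have hd := pow_le_pow_left₀ (norm_nonneg _) (hd.norm_sub_le p q) 2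
  have h : (ca : ℝ) ^ 2 + cb ^ 2 + cc ^ 2 + cd ^ 2 ≤ ((ca : ℝ) + cb + cc + cd) ^ 2 := by
    have : (0 : ℝ) ≤ ca * cb + ca * cc + ca * cd + cb * cc + cb * cd + cc * cd := by positivity
    linarith [show ((ca : ℝ) + cb + cc + cd) ^ 2 = ca ^ 2 + cb ^ 2 + cc ^ 2 + cd ^ 2
      + 2 * (ca * cb + ca * cc + ca * cd + cb * cc + cb * cd + cc * cd) by ring]
  have := mul_le_mul_of_nonneg_right h (sq_nonneg ‖p - q‖)
  simp only [mul_pow] at *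
  linarith

end BigSpace

/-! ### Maps acting componentwise on a Hilbert sum. -/

theorem isMonotoneMap_toLp {ι : Type*} [Fintype ι] {H : ι → Type*} [∀ i, NormedAddCommGroup (H i)]
    [∀ i, InnerProductSpace ℝ (H i)] {f : ∀ i, H i → H i} (hf : ∀ i, IsMonotoneMap (f i)) :
    IsMonotoneMap fun x : PiLp 2 H => (WithLp.toLp 2 (fun i => f i (x i)) : PiLp 2 H) :=
  fun x y => by
    rw [PiLp.inner_apply]
    exact Finset.sum_nonneg fun i _ => hf i (x i) (y i)

theorem isLipschitz_toLp {ι : Type*} [Fintype ι] {H : ι → Type*} [∀ i, NormedAddCommGroup (H i)]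
    [∀ i, InnerProductSpace ℝ (H i)] {f : ∀ i, H i → H i} (hf : ∀ i, IsLipschitz (f i)) :
    IsLipschitz fun x : PiLp 2 H => (WithLp.toLp 2 (fun i => f i (x i)) : PiLp 2 H) :=
  IsLipschitz.toLp fun i => (hf i).comp (.of_continuousLinearMap (PiLp.proj 2 H i : _ →L[ℝ] _))

/-- Only the inequality part of cocoercivity: for an empty family nothing here forces `0 < α`. -/
theorem cocoercive_toLp {ι : Type*} [Fintype ι] {H : ι → Type*} [∀ i, NormedAddCommGroup (H i)]
    [∀ i, InnerProductSpace ℝ (H i)] {f : ∀ i, H i → H i} {c : ι → ℝ} {α : ℝ}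
    (hf : ∀ i, IsCocoercive (c i) (f i)) (hα : ∀ i, α ≤ c i) (x y : PiLp 2 H) :
    α * ‖(WithLp.toLp 2 (fun i => f i (x i)) - WithLp.toLp 2 (fun i => f i (y i)) : PiLp 2 H)‖ ^ 2
      ≤ inner ℝ (x - y) (WithLp.toLp 2 (fun i => f i (x i)) - WithLp.toLp 2 (fun i => f i (y i))) :=
  by
    rw [PiLp.inner_apply, PiLp.norm_sq_eq_of_L2, Finset.mul_sum]
    exact Finset.sum_le_sum fun i _ =>
      (mul_le_mul_of_nonneg_right (hα i) (sq_nonneg _)).trans ((hf i).2 (x i) (y i))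

/-! ### Splitting the saddle operator; maximality of `M` and cocoercivity of `C`. -/

namespace InclusionProblem

variable {I : Type u} {K : Type v} [Fintype I] [Fintype K]
variable {H : I → Type w} [∀ i, NormedAddCommGroup (H i)] [∀ i, InnerProductSpace ℝ (H i)]
  [∀ i, CompleteSpace (H i)]
variable {G : K → Type t} [∀ k, NormedAddCommGroup (G k)] [∀ k, InnerProductSpace ℝ (G k)]
  [∀ k, CompleteSpace (G k)]

/-- The product of the maximally monotone operators of the problem. -/
def opN (P : InclusionProblem H G) (p : BigSpace H G) : Set (BigSpace H G) :=
  box (fun i => P.A i (xPart p i)) (fun k => P.Bm k (yPart p k)) (fun k => P.Dm k (zPart p k))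
    (fun _ => {0})

/-- The skew part of the saddle operator. -/
def skew (P : InclusionProblem H G) : BigSpace H G → BigSpace H G := fun p =>
  mkBig (WithLp.toLp 2 fun i => ∑ k, (P.L k i).adjoint (vPart p k)) (-vPart p) (-vPart p)
    (yPart p + zPart p - WithLp.toLp 2 fun k => ∑ i, P.L k i (xPart p i))

/-- The monotone Lipschitz part of the saddle operator without its skew part. -/
def diag (P : InclusionProblem H G) : BigSpace H G → BigSpace H G := fun p =>
  mkBig (WithLp.toLp 2 (fun i => -P.s i) + WithLp.toLp 2 (fun i => P.Q i (xPart p i))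
      + WithLp.toLp 2 (fun i => P.R i (xPart p)))
    (WithLp.toLp 2 fun k => P.Bl k (yPart p k)) (WithLp.toLp 2 fun k => P.Dl k (zPart p k))
    (WithLp.toLp 2 P.r)

/-- The map is linear, the constants `s` and `r` being kept in `diag`. In its quadratic form the
adjoint terms cancel those of `L`, and the two `-v` rows cancel `y + z`. -/
theorem inner_skew_sub (P : InclusionProblem H G) (p q : BigSpace H G) :
    inner ℝ (p - q) (P.skew p - P.skew q) = 0 := by
  have h : P.skew p - P.skew q = P.skew (p - q) := by
    refine bigSpace_ext (fun i => ?_) (fun k => ?_) (fun k => ?_) (fun k => ?_) <;>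
      simp [skew, Finset.sum_sub_distrib] <;> abel
  rw [h]
  generalize p - q = p
  have h2 : inner ℝ (xPart p) (WithLp.toLp 2 fun i => ∑ k, (P.L k i).adjoint (vPart p k) : PiLp 2 H)
      = inner ℝ (vPart p) (WithLp.toLp 2 fun k => ∑ i, P.L k i (xPart p i) : PiLp 2 G) := by
    simp only [PiLp.inner_apply, inner_sum, ContinuousLinearMap.adjoint_inner_right]
    rw [Finset.sum_comm]
    exact Finset.sum_congr rfl fun k _ => Finset.sum_congr rfl fun i _ => real_inner_comm _ _
  rw [inner_bigSpace]
  simp only [skew, xPart_mkBig, yPart_mkBig, zPart_mkBig, vPart_mkBig, h2, inner_neg_right,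
    inner_sub_right, inner_add_right, real_inner_comm (vPart p) (yPart p),
    real_inner_comm (vPart p) (zPart p)]
  ring

theorem isMonotoneMap_diag (P : InclusionProblem H G) : IsMonotoneMap P.diag := fun p q => by
  have hQ := isMonotoneMap_toLp P.Q_mono (xPart p) (xPart q)
  have hR := P.R_mono (xPart p) (xPart q)
  have hB := isMonotoneMap_toLp P.Bl_mono (yPart p) (yPart q)
  have hD := isMonotoneMap_toLp P.Dl_mono (zPart p) (zPart q)
  rw [inner_bigSpace]
  simp only [diag, xPart_mkBig, yPart_mkBig, zPart_mkBig, vPart_mkBig, xPart_sub, yPart_sub,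
    zPart_sub, vPart_sub, sub_self, inner_zero_right, add_zero]
  rw [add_sub_add_comm, add_sub_add_comm, sub_self, zero_add, inner_add_right]
  linarith

theorem isMonotoneMap_diag_add_skew (P : InclusionProblem H G) :
    IsMonotoneMap fun p => P.diag p + P.skew p := fun p q => by
  rw [add_sub_add_comm, inner_add_right, inner_skew_sub, add_zero]
  exact P.isMonotoneMap_diag p q

theorem isLipschitz_diag (P : InclusionProblem H G) : IsLipschitz P.diag := by
  have hx := IsLipschitz.of_continuousLinearMap (xPartL H G)
  have hy := IsLipschitz.of_continuousLinearMap (yPartL H G)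
  have hz := IsLipschitz.of_continuousLinearMap (zPartL H G)
  refine .mkBig (.add (.add (.const _) ?_) ?_) ?_ ?_ (.const _)
  · exact (isLipschitz_toLp fun i => ⟨_, P.Q_lip i⟩).comp hx
  · exact IsLipschitz.comp
      (g := fun x : PiLp 2 H => (WithLp.toLp 2 (fun i => P.R i x) : PiLp 2 H)) ⟨_, P.R_lip⟩ hx
  · exact (isLipschitz_toLp fun i => ⟨_, P.Bl_lip i⟩).comp hy
  · exact (isLipschitz_toLp fun i => ⟨_, P.Dl_lip i⟩).comp hz

theorem isLipschitz_skew (P : InclusionProblem H G) : IsLipschitz P.skew := by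
  refine .mkBig ?_ ?_ ?_ ?_
  · refine .toLp fun i => .sum fun k => ?_
    exact .of_continuousLinearMap
      ((P.L k i).adjoint ∘L (PiLp.proj 2 G k : _ →L[ℝ] _) ∘L vPartL H G)
  · exact .of_continuousLinearMap (-vPartL H G)
  · exact .of_continuousLinearMap (-vPartL H G)
  · refine .sub (.of_continuousLinearMap (yPartL H G + zPartL H G)) ?_
    refine .toLp fun k => .sum fun i => ?_
    exact .of_continuousLinearMap
      (P.L k i ∘L (PiLp.proj 2 H i : _ →L[ℝ] _) ∘L xPartL H G)

theorem mem_opM (P : InclusionProblem H G) (p p' : BigSpace H G) :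
    p' ∈ P.opM p ↔ p' - (P.diag p + P.skew p) ∈ P.opN p := by
  simp only [opM, opN, box, diag, skew, Set.mem_ofPred_eq, Set.singleton_add, Set.add_singleton,
    Set.image_add_left, Set.image_add_right, Set.mem_preimage, Set.mem_singleton_iff, xPart_sub,
    yPart_sub, zPart_sub, vPart_sub, xPart_add, yPart_add, zPart_add, vPart_add, xPart_mkBig,
    yPart_mkBig, zPart_mkBig, vPart_mkBig, PiLp.sub_apply, PiLp.add_apply, PiLp.neg_apply]
  refine and_congr (forall_congr' fun i => ?_) (and_congr (forall_congr' fun k => ?_)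
    (and_congr (forall_congr' fun k => ?_) (forall_congr' fun k => ?_)))
  · refine iff_of_eq (congrArg (· ∈ P.A i (xPart p i)) ?_)
    abel
  · refine iff_of_eq (congrArg (· ∈ P.Bm k (yPart p k)) ?_)
    abel
  · refine iff_of_eq (congrArg (· ∈ P.Dm k (zPart p k)) ?_)
    abel
  · rw [sub_eq_zero, add_sub_assoc, add_sub_assoc, add_assoc]

theorem mem_saddle (P : InclusionProblem H G) (p p' : BigSpace H G) :
    p' ∈ P.saddle p ↔ p' - P.opC p ∈ P.opM p := by
  simp only [opM, saddle, box, opC, Set.mem_ofPred_eq, Set.singleton_add, Set.add_singleton,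
    Set.image_add_left, Set.image_add_right, Set.mem_preimage, Set.mem_singleton_iff, xPart_sub,
    yPart_sub, zPart_sub, vPart_sub, xPart_mkBig,
    yPart_mkBig, zPart_mkBig, vPart_mkBig, PiLp.sub_apply, sub_zero]
  refine and_congr (forall_congr' fun i => ?_) (and_congr (forall_congr' fun k => ?_)
    (and_congr_left' (forall_congr' fun k => ?_)))
  · refine iff_of_eq (congrArg (· ∈ P.A i (xPart p i)) ?_)
    abel
  · refine iff_of_eq (congrArg (· ∈ P.Bm k (yPart p k)) ?_)
    abel
  · refine iff_of_eq (congrArg (· ∈ P.Dm k (zPart p k)) ?_)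
    abel

theorem opN_monotone (P : InclusionProblem H G) (p p' q q' : BigSpace H G) (hp : p' ∈ P.opN p)
    (hq : q' ∈ P.opN q) : 0 ≤ inner ℝ (p - q) (p' - q') := by
  obtain ⟨hp1, hp2, hp3, hp4⟩ := hp
  obtain ⟨hq1, hq2, hq3, hq4⟩ := hq
  have hv : vPart (p' - q') = 0 := PiLp.ext fun k => by
    rw [vPart_sub, PiLp.sub_apply, hp4 k, hq4 k, sub_zero, PiLp.zero_apply]
  rw [inner_bigSpace, hv, inner_zero_right, add_zero, PiLp.inner_apply, PiLp.inner_apply,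
    PiLp.inner_apply]
  refine add_nonneg (add_nonneg ?_ ?_) ?_ <;> refine Finset.sum_nonneg fun j _ => ?_
  · exact (P.A_max j).inner_nonneg (hp1 j) (hq1 j)
  · exact (P.Bm_max j).inner_nonneg (hp2 j) (hq2 j)
  · exact (P.Dm_max j).inner_nonneg (hp3 j) (hq3 j)

/-- The inclusion decouples over the factors, so Minty's theorem applies to each; on the last block
the operator is zero and its resolvent is the identity. -/
theorem opN_exists_add_smul_eq (P : InclusionProblem H G) {c : ℝ} (hc : 0 < c)
    (z : BigSpace H G) : ∃ p p', p' ∈ P.opN p ∧ p + c • p' = z := by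
  choose x x' hx ex using fun i => (P.A_max i).exists_add_smul_eq hc (xPart z i)
  choose y y' hy ey using fun k => (P.Bm_max k).exists_add_smul_eq hc (yPart z k)
  choose w w' hw ew using fun k => (P.Dm_max k).exists_add_smul_eq hc (zPart z k)
  refine ⟨mkBig (.toLp 2 x) (.toLp 2 y) (.toLp 2 w) (vPart z),
    mkBig (.toLp 2 x') (.toLp 2 y') (.toLp 2 w') 0, ⟨hx, hy, hw, fun k => rfl⟩,
    bigSpace_ext ex ey ew fun k => ?_⟩
  simp

theorem isMaximallyMonotone_opM (P : InclusionProblem H G) : IsMaximallyMonotone P.opM :=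
  let ⟨_, hL⟩ := P.isLipschitz_diag.add P.isLipschitz_skew
  isMaximallyMonotone_of_lipschitz P.mem_opM P.opN_monotone (fun _ => P.opN_exists_add_smul_eq)
    P.isMonotoneMap_diag_add_skew hL

theorem isCocoercive_opC (P : InclusionProblem H G) {α : ℝ} (hα : IsLeast P.cocoConstants α) :
    IsCocoercive α P.opC := by
  obtain ⟨hmem, hle⟩ := hα
  refine ⟨?_, fun p q => ?_⟩
  -- Positivity holds because the minimum is attained by one of the given constants.
  · rcases hmem with (⟨i, rfl⟩ | ⟨k, rfl⟩) | ⟨k, rfl⟩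
    exacts [(P.C_coco i).1, (P.Bc_coco k).1, (P.Dc_coco k).1]
  have h1 := cocoercive_toLp P.C_coco (fun i => hle (.inl (.inl ⟨i, rfl⟩))) (xPart p) (xPart q)
  have h2 := cocoercive_toLp P.Bc_coco (fun i => hle (.inl (.inr ⟨i, rfl⟩))) (yPart p) (yPart q)
  have h3 := cocoercive_toLp P.Dc_coco (fun i => hle (.inr ⟨i, rfl⟩)) (zPart p) (zPart q)
  rw [inner_bigSpace, norm_sq_bigSpace]
  simp only [opC, xPart_mkBig, yPart_mkBig, zPart_mkBig, vPart_mkBig, xPart_sub, yPart_sub,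
    zPart_sub, vPart_sub, sub_self, inner_zero_right, norm_zero]
  linarith

end InclusionProblem

end SaddleForm

end

theorem proposition2 {I : Type*} {K : Type*} [Fintype I] [Fintype K]
    (H : I → Type*) [∀ i, NormedAddCommGroup (H i)] [∀ i, InnerProductSpace ℝ (H i)]
    [∀ i, CompleteSpace (H i)]
    (G : K → Type*) [∀ k, NormedAddCommGroup (G k)] [∀ k, InnerProductSpace ℝ (G k)]
    [∀ k, CompleteSpace (G k)]
    (P : SaddleForm.InclusionProblem H G) :
    (∀ x : SaddleForm.BigSpace H G, P.saddle x = P.opM x + {P.opC x}) ∧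
    SaddleForm.IsMaximallyMonotone P.opM ∧
    ∀ α : ℝ, IsLeast P.cocoConstants α →
      SaddleForm.IsCocoercive α P.opC ∧
      ∀ p p' : SaddleForm.BigSpace H G, (p, p') ∈ SaddleForm.gra P.opM →
        ∀ q : SaddleForm.BigSpace H G,
          SaddleForm.zer P.saddle ⊆
            {x : SaddleForm.BigSpace H G |
              inner ℝ (x - p) (p' + P.opC q) ≤ (4 * α)⁻¹ * ‖p - q‖ ^ 2} := by
  refine ⟨fun x => Set.ext fun x' => ?_, P.isMaximallyMonotone_opM, fun α hα =>
    ⟨P.isCocoercive_opC hα, fun p p' hp q x hx => ?_⟩⟩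
  · rw [P.mem_saddle, Set.add_singleton, Set.image_add_right, Set.mem_preimage, sub_eq_add_neg]
  -- A zero `x` of the saddle operator satisfies `-C x ∈ M x`; monotonicity of `M` against `(p, p')`
  -- leaves only the term `C q - C x` to estimate.
  · have h1 := P.isMaximallyMonotone_opM.inner_nonneg ((P.mem_saddle x 0).1 hx) hp
    have h2 := (P.isCocoercive_opC hα).inner_sub_le x p q
    have e : p' + P.opC q = P.opC q - P.opC x - (0 - P.opC x - p') := by abel
    change inner ℝ (x - p) (p' + P.opC q) ≤ _
    rw [e, inner_sub_right]
    linarith
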